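/- Let $(M,d)$ be a compact metric space with a fully supported Borel probability measure $p$, let $\Omega=M^{\mathbb N}$ carry the product topology and the metric $d_\Omega(x,y)=\sum_{n\ge1}2^{-n}d(x_n,y_n)$, and for $f\in C(\Omega)$ let $\mathscr L_f:C(\Omega)\to C(\Omega)$, $\mathscr L_f\varphi(x)=\int_M e^{f(ax)}\varphi(ax)\,dp(a)$, $ax=(a,x_1,x_2,\ldots)$, be the Ruelle operator, with dual $\mathscr L_f^*$ acting on signed Radon measures. Let $\lambda_f$ be the supremum of $\mathscr L_f^*(\nu)(1)$ over the Borel probability measures $\nu$ on $\Omega$ that are fixed points of $\gamma\mapsto\mathscr L_f^*\gamma/\mathscr L_f^*\gamma(1)$. Let $f\in C(\Omega)$, and let $\nu_f$ be a Borel probability measure with $\mathscr L_f^*\nu_f=\lambda_f\nu_f$; the operator $\mathscr L_f$ then extends uniquely to a bounded linear operator on $L^1(\nu_f)$, also denoted $\mathscr L_f$. Let $(f_n)$ be Hölder continuous functions on $(\Omega,d_\Omega)$ with $\|f_n-f\|_\infty\to0$. For each $n$ let $h_{f_n}$ be a strictly positive continuous function with $\mathscr L_{f_n}h_{f_n}=\lambda_{f_n}h_{f_n}$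 and $\|h_{f_n}\|_{L^1(\nu_f)}=1$, and let $\mu_{f_n}$ be the probability measure $\mu_{f_n}(E)=\int_E h_{f_n}\,d\nu_f$. If $\{h_{f_n}:n\in\mathbb N\}$ is relatively compact in $L^1(\nu_f)$, then there are a subsequence $(\mu_{f_{n_k}})$ and a Borel probability measure $\mu$ on $\Omega$ such that $\mu_{f_{n_k}}\rightharpoonup\mu$ weakly and $\mu\ll\nu_f$, and the Radon–Nikodym derivative $d\mu/d\nu_f$ is a nonnegative, nonzero element of $L^1(\nu_f)$ with $\mathscr L_f(d\mu/d\nu_f)=\lambda_f\,d\mu/d\nu_f$ in $L^1(\nu_f)$. -/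

import Mathlib

noncomputable section

namespace RuelleOp

open MeasureTheory

/-- The point `ax = (a, x₀, x₁, …)` of `M^ℕ`, for `a : M` and `x = (x₀, x₁, …)`. -/
def cons {M : Type*} (a : M) (x : ℕ → M) : ℕ → M
  | 0 => a
  | n + 1 => x n

theorem continuous_cons {M : Type*} [TopologicalSpace M] :
    Continuous (fun q : (ℕ → M) × M => cons q.2 q.1) := by
  refine continuous_pi fun n => ?_
  cases n with
  | zero => exact continuous_snd
  | succ n => exact (continuous_apply n).comp continuous_fst

/-- The metric `d_Ω(x, y) = ∑_{n ≥ 0} 2^{-(n+1)} d(x_n, y_n)` on `Ω = M^ℕ`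
(coordinates are numbered from `0`). -/
def distOmega {M : Type*} [MetricSpace M] (x y : ℕ → M) : ℝ :=
  ∑' n : ℕ, (1 / 2 : ℝ) ^ (n + 1) * dist (x n) (y n)

/-- `φ ∈ C^γ(Ω)`: the function `φ` is `γ`-Hölder for the metric `d_Ω`. -/
def IsHolder {M : Type*} [MetricSpace M] (γ : ℝ) (φ : (ℕ → M) → ℝ) : Prop :=
  ∃ C : ℝ, ∀ x y : ℕ → M, |φ x - φ y| ≤ C * distOmega x y ^ γ

theorem integrand_continuous {M : Type*} [MetricSpace M] (f φ : C(ℕ → M, ℝ)) (x : ℕ → M) :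
    Continuous (fun a : M => Real.exp (f (cons a x)) * φ (cons a x)) := by
  have h : Continuous (fun a : M => cons a x) :=
    continuous_cons.comp (Continuous.prodMk_right x)
  exact (Real.continuous_exp.comp (f.continuous.comp h)).mul (φ.continuous.comp h)

variable {M : Type*} [MetricSpace M] [CompactSpace M] [MeasurableSpace M] [BorelSpace M]

theorem integrand_integrable (p : Measure M) [IsProbabilityMeasure p]
    (f φ : C(ℕ → M, ℝ)) (x : ℕ → M) :
    Integrable (fun a : M => Real.exp (f (cons a x)) * φ (cons a x)) p := by
  simpa using (integrand_continuous f φ x).continuousOn.integrableOn_compact (μ := p)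
    isCompact_univ

theorem ruelle_continuous (p : Measure M) [IsProbabilityMeasure p] (f φ : C(ℕ → M, ℝ)) :
    Continuous (fun x : ℕ → M => ∫ a, Real.exp (f (cons a x)) * φ (cons a x) ∂p) := by
  have h : Continuous (Function.uncurry
      (fun (x : ℕ → M) (a : M) => Real.exp (f (cons a x)) * φ (cons a x))) :=
    (Real.continuous_exp.comp (f.continuous.comp continuous_cons)).mul
      (φ.continuous.comp continuous_cons)
  simpa using continuous_parametric_integral_of_continuous (μ := p) h isCompact_univ

/-- The Ruelle operator `(L_f φ)(x) = ∫_M exp(f(ax)) φ(ax) dp(a)` as a bounded linear operator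
on `C(Ω)`, with a priori probability measure `p` on `M`. -/
def ruelle (p : Measure M) [IsProbabilityMeasure p] (f : C(ℕ → M, ℝ)) :
    C(ℕ → M, ℝ) →L[ℝ] C(ℕ → M, ℝ) :=
  LinearMap.mkContinuous
    { toFun := fun φ =>
        ⟨fun x => ∫ a, Real.exp (f (cons a x)) * φ (cons a x) ∂p, ruelle_continuous p f φ⟩
      map_add' := fun φ ψ => by
        ext x
        simp only [ContinuousMap.coe_mk, ContinuousMap.add_apply, mul_add]
        exact integral_add (integrand_integrable p f φ x) (integrand_integrable p f ψ x)
      map_smul' := fun c φ => by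
        ext x
        simp only [ContinuousMap.coe_mk, ContinuousMap.smul_apply, smul_eq_mul, RingHom.id_apply,
          mul_left_comm _ c]
        exact integral_const_mul c _ }
    (Real.exp ‖f‖) (fun φ => by
      refine (ContinuousMap.norm_le _ (by positivity)).2 fun x => ?_
      have h := norm_integral_le_of_norm_le_const (μ := p) (C := Real.exp ‖f‖ * ‖φ‖)
        (f := fun a : M => Real.exp (f (cons a x)) * φ (cons a x))
        (Filter.Eventually.of_forall fun a => by
          rw [norm_mul]
          refine mul_le_mul ?_ (φ.norm_coe_le_norm _) (norm_nonneg _) (Real.exp_pos _).le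
          rw [Real.norm_of_nonneg (Real.exp_pos _).le]
          exact Real.exp_le_exp.2 ((le_abs_self _).trans (f.norm_coe_le_norm _)))
      simpa using h)

theorem ruelle_apply (p : Measure M) [IsProbabilityMeasure p] (f φ : C(ℕ → M, ℝ)) (x : ℕ → M) :
    ruelle p f φ x = ∫ a, Real.exp (f (cons a x)) * φ (cons a x) ∂p := rfl

theorem integrable_cont (ν : ProbabilityMeasure (ℕ → M)) (φ : C(ℕ → M, ℝ)) :
    Integrable φ (ν : Measure (ℕ → M)) := by
  simpa using φ.continuous.continuousOn.integrableOn_compact (μ := (ν : Measure (ℕ → M)))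
    isCompact_univ

/-- The element `φ ↦ ∫ φ dν` of `C(Ω)*` which represents the probability measure `ν`
under the Riesz-Markov identification of `C(Ω)*` with the signed Radon measures. -/
def functional (ν : ProbabilityMeasure (ℕ → M)) : StrongDual ℝ C(ℕ → M, ℝ) :=
  LinearMap.mkContinuous
    { toFun := fun φ => ∫ x, φ x ∂(ν : Measure (ℕ → M))
      map_add' := fun φ ψ => integral_add (integrable_cont ν φ) (integrable_cont ν ψ)
      map_smul' := fun c φ => integral_const_mul c _ }
    1 (fun φ => by
      simpa using norm_integral_le_of_norm_le_const (μ := (ν : Measure (ℕ → M))) (f := φ)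
        (Filter.Eventually.of_forall fun x => φ.norm_coe_le_norm x))

theorem functional_apply (ν : ProbabilityMeasure (ℕ → M)) (φ : C(ℕ → M, ℝ)) :
    functional ν φ = ∫ x, φ x ∂(ν : Measure (ℕ → M)) := rfl

/-- The dual operator `L_f^*` on `C(Ω)*`, given by `(L_f^* ℓ)(φ) = ℓ(L_f φ)`. -/
def ruelleDual (p : Measure M) [IsProbabilityMeasure p] (f : C(ℕ → M, ℝ))
    (l : StrongDual ℝ C(ℕ → M, ℝ)) : StrongDual ℝ C(ℕ → M, ℝ) :=
  l.comp (ruelle p f)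

/-- `λ_f`: the supremum of `(L_f^* ν)(1)` over the Borel probability measures `ν` on `Ω` that are
fixed by `γ ↦ L_f^* γ / (L_f^* γ)(1)`. -/
def eigenvalue (p : Measure M) [IsProbabilityMeasure p] (f : C(ℕ → M, ℝ)) : ℝ :=
  sSup {r : ℝ | ∃ ν : ProbabilityMeasure (ℕ → M),
    (ruelleDual p f (functional ν) 1)⁻¹ • ruelleDual p f (functional ν) = functional ν ∧
      r = ruelleDual p f (functional ν) 1}

/-- `𝒢^*(f)`: the Borel probability measures `ν` on `Ω` with `L_f^* ν = λ_f ν`. -/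
def eigenprobabilities (p : Measure M) [IsProbabilityMeasure p] (f : C(ℕ → M, ℝ)) :
    Set (ProbabilityMeasure (ℕ → M)) :=
  {ν | ruelleDual p f (functional ν) = eigenvalue p f • functional ν}

/-- `h` is a Ruelle-Perron-Frobenius eigenfunction of `L_f`: a strictly positive continuous
function with `L_f h = λ_f h`. -/
structure IsRPFEigenfunction (p : Measure M) [IsProbabilityMeasure p]
    (f h : C(ℕ → M, ℝ)) : Prop where
  pos : ∀ x, 0 < h x
  eigen : ruelle p f h = eigenvalue p f • h

/-- The class in `L¹(Ω, ν)` of a continuous function. -/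
def toL1 (ν : ProbabilityMeasure (ℕ → M)) :
    C(ℕ → M, ℝ) →L[ℝ] Lp ℝ 1 (ν : Measure (ℕ → M)) :=
  ContinuousMap.toLp 1 (ν : Measure (ℕ → M)) ℝ

/-- The bounded linear extension of `L_f : C(Ω) → C(Ω)` to `L¹(Ω, ν)`; for `ν ∈ 𝒢^*(f)` it
exists and is unique, see `ruelleL1_toL1` and `ruelleL1_unique`. -/
def ruelleL1 (p : Measure M) [IsProbabilityMeasure p] (f : C(ℕ → M, ℝ))
    (ν : ProbabilityMeasure (ℕ → M)) :
    Lp ℝ 1 (ν : Measure (ℕ → M)) →L[ℝ] Lp ℝ 1 (ν : Measure (ℕ → M)) :=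
  ((toL1 ν).toLinearMap ∘ₗ (ruelle p f).toLinearMap).extendOfNorm (toL1 ν).toLinearMap

theorem toL1_denseRange (ν : ProbabilityMeasure (ℕ → M)) : DenseRange (toL1 ν) :=
  ContinuousMap.toLp_denseRange ℝ (ν : Measure (ℕ → M)) ℝ ENNReal.one_ne_top

theorem norm_toL1 (ν : ProbabilityMeasure (ℕ → M)) (φ : C(ℕ → M, ℝ)) :
    ‖toL1 ν φ‖ = ∫ x, |φ x| ∂(ν : Measure (ℕ → M)) := by
  rw [L1.norm_eq_integral_norm]
  refine integral_congr_ae ?_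
  filter_upwards [ContinuousMap.coeFn_toLp (p := 1) (𝕜 := ℝ) (ν : Measure (ℕ → M)) φ] with x hx
  rw [toL1, hx, Real.norm_eq_abs]

theorem norm_toL1_ruelle_le (p : Measure M) [IsProbabilityMeasure p] (f : C(ℕ → M, ℝ))
    {ν : ProbabilityMeasure (ℕ → M)} (hν : ν ∈ eigenprobabilities p f) (φ : C(ℕ → M, ℝ)) :
    ‖toL1 ν (ruelle p f φ)‖ ≤ eigenvalue p f * ‖toL1 ν φ‖ := by
  let ψ : C(ℕ → M, ℝ) := ⟨fun x => |φ x|, φ.continuous.abs⟩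
  have h1 : ∫ x, ruelle p f ψ x ∂(ν : Measure (ℕ → M))
      = eigenvalue p f * ∫ x, |φ x| ∂(ν : Measure (ℕ → M)) :=
    DFunLike.congr_fun hν ψ
  rw [norm_toL1, norm_toL1, ← h1]
  refine integral_mono (integrable_cont ν (ruelle p f φ)).abs
    (integrable_cont ν (ruelle p f ψ)) fun x => ?_
  simp only [ruelle_apply]
  refine (abs_integral_le_integral_abs).trans (le_of_eq ?_)
  refine integral_congr_ae (Filter.Eventually.of_forall fun a => ?_)
  simp [ψ, abs_mul]

theorem ruelleL1_toL1 (p : Measure M) [IsProbabilityMeasure p] (f : C(ℕ → M, ℝ))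
    {ν : ProbabilityMeasure (ℕ → M)} (hν : ν ∈ eigenprobabilities p f) (φ : C(ℕ → M, ℝ)) :
    ruelleL1 p f ν (toL1 ν φ) = toL1 ν (ruelle p f φ) :=
  LinearMap.extendOfNorm_eq (toL1_denseRange ν) ⟨_, norm_toL1_ruelle_le p f hν⟩ φ

theorem ruelleL1_unique (p : Measure M) [IsProbabilityMeasure p] (f : C(ℕ → M, ℝ))
    {ν : ProbabilityMeasure (ℕ → M)} (hν : ν ∈ eigenprobabilities p f)
    (T : Lp ℝ 1 (ν : Measure (ℕ → M)) →L[ℝ] Lp ℝ 1 (ν : Measure (ℕ → M)))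
    (hT : ∀ φ, T (toL1 ν φ) = toL1 ν (ruelle p f φ)) : ruelleL1 p f ν = T :=
  LinearMap.extendOfNorm_unique (toL1_denseRange ν) _ (norm_toL1_ruelle_le p f hν) T
    (LinearMap.ext hT)

/-- The Borel probability measure `E ↦ ∫_E h dν`, for a nonnegative continuous `h` of
`L¹(ν)`-norm one. -/
def densityMeasure (ν : ProbabilityMeasure (ℕ → M)) (h : C(ℕ → M, ℝ)) (h0 : ∀ x, 0 ≤ h x)
    (h1 : ‖toL1 ν h‖ = 1) : ProbabilityMeasure (ℕ → M) :=
  ⟨(ν : Measure (ℕ → M)).withDensity (fun x => ENNReal.ofReal (h x)), ⟨by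
    rw [withDensity_apply _ MeasurableSet.univ, Measure.restrict_univ,
      ← ofReal_integral_eq_lintegral_ofReal (integrable_cont ν h)
        (Filter.Eventually.of_forall h0), ENNReal.ofReal_eq_one, ← h1, norm_toL1]
    simp only [abs_of_nonneg (h0 _)]⟩⟩

/-- The Radon-Nikodym derivative `dμ/dν` as an element of `L¹(Ω, ν)`. -/
def rnDerivL1 (μ ν : ProbabilityMeasure (ℕ → M)) : Lp ℝ 1 (ν : Measure (ℕ → M)) :=
  (Measure.integrable_toReal_rnDeriv (μ := (μ : Measure (ℕ → M)))
    (ν := (ν : Measure (ℕ → M)))).toL1 _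

end RuelleOp

end

namespace RuelleOp

open MeasureTheory Filter Topology

/-! ### Perturbation of the potential, measured in `L¹(ν)`. -/

section Perturbation

variable {M : Type*} [MetricSpace M] [CompactSpace M] [MeasurableSpace M] [BorelSpace M]

/-! Since `e^g` and `e^f` differ by a factor within `e^{±‖g - f‖}`, the error `L_g φ - L_f φ` for `φ
≥ 0` is controlled by `L_f φ` itself. Integrating against `ν`, an eigenvector of the dual of `L_f`,
bounds it by the `L¹(ν)` norm of `φ`; no uniform bound on `φ` is needed. Hence the normalized
eigenfunctions `h n` satisfy the eigenvalue equation of `L_f` up to an `L¹(ν)` error tending to zero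
(`norm_ruelleL1_sub_smul_le`). Compactness gives an `L¹(ν)` limit `g` of a subsequence, and
continuity of `ruelleL1` makes `g` an exact eigenvector. It is nonnegative of norm one, hence the
density of a probability measure, and `tendsto_measureOfL1` gives weak convergence to it. -/

/-- Changing the potential changes the Ruelle operator on nonnegative functions by a small
multiple of the operator itself. -/
theorem abs_ruelle_sub_ruelle_le (p : Measure M) [IsProbabilityMeasure p]
    (f g φ : C(ℕ → M, ℝ)) (hφ : ∀ x, 0 ≤ φ x) (x : ℕ → M) :
    |ruelle p g φ x - ruelle p f φ x| ≤ (Real.exp ‖g - f‖ - 1) * ruelle p f φ x := by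
  simp only [ruelle_apply]
  rw [← integral_sub (integrand_integrable p g φ x) (integrand_integrable p f φ x),
    ← integral_const_mul, ← Real.norm_eq_abs]
  refine norm_integral_le_of_norm_le ((integrand_integrable p f φ x).const_mul _)
    (Eventually.of_forall fun a => ?_)
  set y := cons a x
  have hgf : |g y - f y| ≤ ‖g - f‖ := (g - f).norm_coe_le_norm y
  have hexp : Real.exp (g y) = Real.exp (f y) * Real.exp (g y - f y) := by
    rw [← Real.exp_add]; ring_nf
  -- With `t = g y - f y` and `s = ‖g - f‖`, the lower bound is `e^t + e^s ≥ 2 + t + s ≥ 2`.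
  have hone : |Real.exp (g y - f y) - 1| ≤ Real.exp ‖g - f‖ - 1 := by
    obtain ⟨h1, h2⟩ := abs_le.1 hgf
    have h3 := Real.exp_le_exp.2 h2
    have h4 := Real.add_one_le_exp (g y - f y)
    have h5 := Real.add_one_le_exp ‖g - f‖
    exact abs_le.2 ⟨by linarith, by linarith⟩
  have hpos : 0 ≤ Real.exp (f y) * φ y := mul_nonneg (Real.exp_pos _).le (hφ y)
  calc ‖Real.exp (g y) * φ y - Real.exp (f y) * φ y‖
      = |Real.exp (g y - f y) - 1| * (Real.exp (f y) * φ y) := by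
        rw [hexp, Real.norm_eq_abs, ← abs_of_nonneg hpos, ← abs_mul, abs_of_nonneg hpos]
        ring_nf
    _ ≤ _ := mul_le_mul_of_nonneg_right hone hpos

/-- The dual eigenvalue equation, integrated against a continuous function. -/
theorem integral_ruelle (p : Measure M) [IsProbabilityMeasure p] (f : C(ℕ → M, ℝ))
    {ν : ProbabilityMeasure (ℕ → M)} (hν : ν ∈ eigenprobabilities p f) (φ : C(ℕ → M, ℝ)) :
    ∫ x, ruelle p f φ x ∂(ν : Measure (ℕ → M))
      = eigenvalue p f * ∫ x, φ x ∂(ν : Measure (ℕ → M)) :=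
  DFunLike.congr_fun hν φ

theorem integral_eq_norm_toL1 (ν : ProbabilityMeasure (ℕ → M)) (φ : C(ℕ → M, ℝ))
    (hφ : ∀ x, 0 ≤ φ x) : ∫ x, φ x ∂(ν : Measure (ℕ → M)) = ‖toL1 ν φ‖ := by
  simp only [norm_toL1, abs_of_nonneg (hφ _)]

theorem norm_toL1_ruelle_sub_ruelle_le (p : Measure M) [IsProbabilityMeasure p]
    (f g φ : C(ℕ → M, ℝ)) {ν : ProbabilityMeasure (ℕ → M)} (hν : ν ∈ eigenprobabilities p f)
    (hφ : ∀ x, 0 ≤ φ x) :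
    ‖toL1 ν (ruelle p g φ - ruelle p f φ)‖
      ≤ (Real.exp ‖g - f‖ - 1) * (eigenvalue p f * ‖toL1 ν φ‖) := by
  rw [norm_toL1, ← integral_eq_norm_toL1 ν φ hφ, ← integral_ruelle p f hν φ, ← integral_const_mul]
  exact integral_mono (integrable_cont ν (ruelle p g φ - ruelle p f φ)).abs
    ((integrable_cont ν (ruelle p f φ)).const_mul _) fun x =>
      abs_ruelle_sub_ruelle_le p f g φ hφ x

/-- Since `∫ φ dν = 1`, integrating `L_g φ` and `L_f φ` against `ν` gives exactly the two
eigenvalues: the first because `φ` is an eigenfunction, the second by duality. -/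
theorem abs_eigenvalue_sub_eigenvalue_le (p : Measure M) [IsProbabilityMeasure p]
    (f g φ : C(ℕ → M, ℝ)) {ν : ProbabilityMeasure (ℕ → M)} (hν : ν ∈ eigenprobabilities p f)
    (hφ : IsRPFEigenfunction p g φ) (hnorm : ‖toL1 ν φ‖ = 1) :
    |eigenvalue p g - eigenvalue p f| ≤ (Real.exp ‖g - f‖ - 1) * eigenvalue p f := by
  have hpos : ∀ x, 0 ≤ φ x := fun x => (hφ.pos x).le
  have hint : ∫ x, φ x ∂(ν : Measure (ℕ → M)) = 1 := by
    rw [integral_eq_norm_toL1 ν φ hpos, hnorm]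
  have hdiff : ∫ x, (ruelle p g φ - ruelle p f φ) x ∂(ν : Measure (ℕ → M))
      = eigenvalue p g - eigenvalue p f := by
    simp only [ContinuousMap.sub_apply]
    rw [integral_sub (integrable_cont ν _) (integrable_cont ν _), integral_ruelle p f hν, hφ.eigen]
    simp only [ContinuousMap.smul_apply, smul_eq_mul]
    rw [integral_const_mul, hint, mul_one, mul_one]
  have hbound := norm_toL1_ruelle_sub_ruelle_le p f g φ hν hpos
  rw [hnorm, mul_one, norm_toL1] at hbound
  rw [← hdiff]
  exact abs_integral_le_integral_abs.trans hbound

/-- Approximate eigenfunctions: a normalized eigenfunction of `L_g` almost solves the eigenvalue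
equation of `L_f` in `L¹(ν)`. -/
theorem norm_ruelleL1_sub_smul_le (p : Measure M) [IsProbabilityMeasure p]
    (f g φ : C(ℕ → M, ℝ)) {ν : ProbabilityMeasure (ℕ → M)} (hν : ν ∈ eigenprobabilities p f)
    (hφ : IsRPFEigenfunction p g φ) (hnorm : ‖toL1 ν φ‖ = 1) :
    ‖ruelleL1 p f ν (toL1 ν φ) - eigenvalue p f • toL1 ν φ‖
      ≤ 2 * ((Real.exp ‖g - f‖ - 1) * eigenvalue p f) := by
  have h1 := norm_toL1_ruelle_sub_ruelle_le p f g φ hν fun x => (hφ.pos x).le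
  have h2 := abs_eigenvalue_sub_eigenvalue_le p f g φ hν hφ hnorm
  rw [hnorm, mul_one] at h1
  -- One error comes from the eigenvalue and one from the operator, with the same bound; hence the
  -- factor `2`.
  have hsplit : ruelleL1 p f ν (toL1 ν φ) - eigenvalue p f • toL1 ν φ
      = (eigenvalue p g - eigenvalue p f) • toL1 ν φ
        - toL1 ν (ruelle p g φ - ruelle p f φ) := by
    rw [ruelleL1_toL1 p f hν, map_sub, hφ.eigen, map_smul, sub_smul]
    abel
  rw [hsplit]
  refine (norm_sub_le _ _).trans ?_
  rw [norm_smul, hnorm, mul_one, Real.norm_eq_abs]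
  linarith

end Perturbation

/-! ### Probability measures with densities in the positive cone of `L¹(ν)`. -/

section Density

variable {M : Type*} [MeasurableSpace M]

/-- The probability measure with a given density of norm one in the positive cone of `L¹(ν)`. -/
noncomputable def measureOfL1 (ν : ProbabilityMeasure (ℕ → M)) (g : Lp ℝ 1 (ν : Measure (ℕ → M)))
    (h0 : 0 ≤ g) (h1 : ‖g‖ = 1) : ProbabilityMeasure (ℕ → M) :=
  ⟨(ν : Measure (ℕ → M)).withDensity (fun x => ENNReal.ofReal (g x)), ⟨by
    -- The order on `Lp` is almost everywhere, so `ENNReal.ofReal` alters `g` only on a null set.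
    have hg := (Lp.coeFn_nonneg g).2 h0
    rw [withDensity_apply _ MeasurableSet.univ, Measure.restrict_univ,
      ← ofReal_integral_eq_lintegral_ofReal (L1.integrable_coeFn g) hg,
      ENNReal.ofReal_eq_one, ← h1, L1.norm_eq_integral_norm]
    refine integral_congr_ae ?_
    filter_upwards [hg] with x hx
    exact (Real.norm_of_nonneg hx).symm⟩⟩

theorem rnDerivL1_measureOfL1 (ν : ProbabilityMeasure (ℕ → M))
    (g : Lp ℝ 1 (ν : Measure (ℕ → M))) (h0 : 0 ≤ g) (h1 : ‖g‖ = 1) :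
    rnDerivL1 (measureOfL1 ν g h0 h1) ν = g := by
  refine Lp.ext ?_
  refine (Integrable.coeFn_toL1 _).trans ?_
  filter_upwards [Measure.rnDeriv_withDensity₀ (ν : Measure (ℕ → M))
    (L1.integrable_coeFn g).aemeasurable.ennreal_ofReal, (Lp.coeFn_nonneg g).2 h0] with x hx hx0
  change (Measure.rnDeriv ((ν : Measure (ℕ → M)).withDensity
    (fun x => ENNReal.ofReal (g x))) (ν : Measure (ℕ → M)) x).toReal = g x
  rw [hx, ENNReal.toReal_ofReal hx0]

theorem integral_measureOfL1 (ν : ProbabilityMeasure (ℕ → M))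
    (g : Lp ℝ 1 (ν : Measure (ℕ → M))) (h0 : 0 ≤ g) (h1 : ‖g‖ = 1) (φ : (ℕ → M) → ℝ) :
    ∫ x, φ x ∂(measureOfL1 ν g h0 h1 : Measure (ℕ → M))
      = ∫ x, g x * φ x ∂(ν : Measure (ℕ → M)) := by
  change ∫ x, φ x ∂((ν : Measure (ℕ → M)).withDensity (fun x => ENNReal.ofReal (g x))) = _
  rw [integral_withDensity_eq_integral_toReal_smul₀
    (L1.integrable_coeFn g).aemeasurable.ennreal_ofReal
    (Eventually.of_forall fun _ => ENNReal.ofReal_lt_top)]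
  refine integral_congr_ae ?_
  filter_upwards [(Lp.coeFn_nonneg g).2 h0] with x hx
  rw [ENNReal.toReal_ofReal hx, smul_eq_mul]

variable [MetricSpace M] [CompactSpace M] [BorelSpace M]

theorem toL1_nonneg (ν : ProbabilityMeasure (ℕ → M)) {φ : C(ℕ → M, ℝ)} (hφ : ∀ x, 0 ≤ φ x) :
    0 ≤ toL1 ν φ := by
  rw [← Lp.coeFn_nonneg]
  filter_upwards [ContinuousMap.coeFn_toLp (p := 1) (𝕜 := ℝ) (ν : Measure (ℕ → M)) φ] with x hx
  rw [toL1, hx]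
  exact hφ x

theorem measureOfL1_toL1 (ν : ProbabilityMeasure (ℕ → M)) (φ : C(ℕ → M, ℝ))
    (h0 : ∀ x, 0 ≤ φ x) (h1 : ‖toL1 ν φ‖ = 1) :
    densityMeasure ν φ h0 h1 = measureOfL1 ν (toL1 ν φ) (toL1_nonneg ν h0) h1 := by
  refine Subtype.ext (withDensity_congr_ae ?_)
  filter_upwards [ContinuousMap.coeFn_toLp (p := 1) (𝕜 := ℝ) (ν : Measure (ℕ → M)) φ] with x hx
  rw [toL1, hx]

/-- Convergence of densities in `L¹(ν)` implies weak convergence of the measures. -/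
theorem tendsto_measureOfL1 (ν : ProbabilityMeasure (ℕ → M))
    {G : ℕ → Lp ℝ 1 (ν : Measure (ℕ → M))} {g : Lp ℝ 1 (ν : Measure (ℕ → M))}
    (hG0 : ∀ n, 0 ≤ G n) (hG1 : ∀ n, ‖G n‖ = 1) (h0 : 0 ≤ g) (h1 : ‖g‖ = 1)
    (hlim : Tendsto G atTop (𝓝 g)) :
    Tendsto (fun n => measureOfL1 ν (G n) (hG0 n) (hG1 n)) atTop (𝓝 (measureOfL1 ν g h0 h1)) := by
  refine ProbabilityMeasure.tendsto_iff_forall_integral_tendsto.2 fun φ => ?_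
  simp only [integral_measureOfL1]
  have hint : ∀ u : Lp ℝ 1 (ν : Measure (ℕ → M)),
      Integrable (fun x => u x * φ x) (ν : Measure (ℕ → M)) := fun u =>
    (L1.integrable_coeFn u).mul_bdd (c := ‖φ‖) φ.continuous.aestronglyMeasurable
      (Eventually.of_forall φ.norm_coe_le_norm)
  rw [tendsto_iff_norm_sub_tendsto_zero]
  have hnorm : Tendsto (fun n => ‖G n - g‖ * ‖φ‖) atTop (𝓝 0) := by
    simpa using (tendsto_iff_norm_sub_tendsto_zero.1 hlim).mul_const ‖φ‖
  refine squeeze_zero (fun _ => norm_nonneg _) (fun n => ?_) hnorm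
  -- The `L¹`–`L^∞` pairing: `|∫ (G n - g) φ dν| ≤ ‖G n - g‖ ‖φ‖`.
  rw [← integral_sub (hint _) (hint _), L1.norm_eq_integral_norm, ← integral_mul_const]
  refine norm_integral_le_of_norm_le ((L1.integrable_coeFn (G n - g)).norm.mul_const _) ?_
  filter_upwards [Lp.coeFn_sub (G n) g] with x hx
  rw [hx, ← sub_mul, norm_mul]
  exact mul_le_mul_of_nonneg_left (φ.norm_coe_le_norm x) (norm_nonneg _)

end Density

end RuelleOp

/-! ### Passage to the limit along a convergent subsequence. -/

open MeasureTheory Filter Topology RuelleOp in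
theorem mainTheorem8 {M : Type*} [MetricSpace M] [CompactSpace M] [MeasurableSpace M]
    [BorelSpace M] (p : MeasureTheory.Measure M) [MeasureTheory.IsProbabilityMeasure p]
    [p.IsOpenPosMeasure]
    (f : C(ℕ → M, ℝ)) (ν : MeasureTheory.ProbabilityMeasure (ℕ → M))
    (hν : ν ∈ RuelleOp.eigenprobabilities p f)
    (fn : ℕ → C(ℕ → M, ℝ))
    (hfn : ∀ n, ∃ γ : ℝ, 0 < γ ∧ γ ≤ 1 ∧ RuelleOp.IsHolder γ (fn n))
    (hlim : Filter.Tendsto (fun n => ‖fn n - f‖) Filter.atTop (nhds 0))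
    (h : ℕ → C(ℕ → M, ℝ))
    (hh : ∀ n, RuelleOp.IsRPFEigenfunction p (fn n) (h n))
    (hnorm : ∀ n, ‖RuelleOp.toL1 ν (h n)‖ = 1)
    (hcpt : IsCompact (closure (Set.range fun n => RuelleOp.toL1 ν (h n)))) :
    ∃ (μ : MeasureTheory.ProbabilityMeasure (ℕ → M)) (k : ℕ → ℕ),
      StrictMono k ∧
      Filter.Tendsto
        (fun j => RuelleOp.densityMeasure ν (h (k j)) (fun x => ((hh (k j)).pos x).le)
          (hnorm (k j)))
        Filter.atTop (nhds μ) ∧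
      MeasureTheory.Measure.AbsolutelyContinuous
        (μ : MeasureTheory.Measure (ℕ → M)) (ν : MeasureTheory.Measure (ℕ → M)) ∧
      0 ≤ RuelleOp.rnDerivL1 μ ν ∧
      RuelleOp.rnDerivL1 μ ν ≠ 0 ∧
      RuelleOp.ruelleL1 p f ν (RuelleOp.rnDerivL1 μ ν)
        = RuelleOp.eigenvalue p f • RuelleOp.rnDerivL1 μ ν := by
  obtain ⟨g, -, k, hk, hg⟩ := hcpt.tendsto_subseq
    (x := fun n => toL1 ν (h n)) fun n => subset_closure (Set.mem_range_self n)
  have hpos : ∀ n, 0 ≤ toL1 ν (h n) := fun n => toL1_nonneg ν fun x => ((hh n).pos x).le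
  have h0 : 0 ≤ g := ge_of_tendsto' hg fun j => hpos (k j)
  -- Strong convergence preserves the norm, which rules out a zero limit.
  have h1 : ‖g‖ = 1 :=
    tendsto_nhds_unique hg.norm (by simp only [Function.comp_def, hnorm, tendsto_const_nhds])
  have hd := rnDerivL1_measureOfL1 ν g h0 h1
  refine ⟨measureOfL1 ν g h0 h1, k, hk, ?_, withDensity_absolutelyContinuous _ _, ?_, ?_, ?_⟩
  · simp only [measureOfL1_toL1]
    exact tendsto_measureOfL1 ν (fun j => hpos (k j)) (fun j => hnorm (k j)) h0 h1 hg
  · rwa [hd]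
  · rw [hd, ← norm_ne_zero_iff, h1]
    exact one_ne_zero
  · rw [hd, ← sub_eq_zero]
    have herr : Tendsto (fun j => 2 * ((Real.exp ‖fn (k j) - f‖ - 1) * eigenvalue p f))
        atTop (𝓝 0) := by
      simpa using ((((Real.continuous_exp.tendsto 0).comp
        (hlim.comp hk.tendsto_atTop)).sub_const 1).mul_const (eigenvalue p f)).const_mul 2
    -- The defects `L_f h - λ_f h` along the subsequence converge to the defect of `g` by
    -- continuity, and to `0` by `herr`.
    refine tendsto_nhds_unique (((ruelleL1 p f ν).continuous.tendsto g |>.comp hg).sub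
      (hg.const_smul (eigenvalue p f))) ?_
    exact squeeze_zero_norm (fun j => norm_ruelleL1_sub_smul_le p f (fn (k j)) (h (k j)) hν
      (hh (k j)) (hnorm (k j))) herr
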